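/- For complex $a,q$ with $|q|<1$ put $(a;q)_n=\prod_{k=0}^{n-1}(1-aq^k)$ for $n=0,1,2,\dots$, $(a;q)_\infty=\prod_{k=0}^{\infty}(1-aq^k)$, and $(a_1,\dots,a_m;q)_n=(a_1;q)_n\cdots(a_m;q)_n$ (also for $n=\infty$). Let $q\in\mathbb{C}$ with $|q|<1$. (i) For all nonzero $a,b\in\mathbb{C}$ with $\max\{|aq^3|,|bq^3|,|abq^2|\}<1$, both series below converge absolutely and $$\frac{(q^3,abq^2;q)_\infty}{(aq^3,bq^3;q)_\infty}\sum_{n=0}^{\infty}\frac{(q/a,q/b;q)_n\,(q^3;q^3)_n}{(q;q)_n\,(q^3;q)_{2n}}\,a^nb^nq^{2n} =\sum_{n=0}^{\infty}(-1)^n(1-q^{6n+3})\frac{(q/a,q/b;q)_{3n}}{(aq^3,bq^3;q)_{3n}}\,a^{3n}b^{3n}q^{\frac{9n^2+15n}{2}}.$$ (ii) The following identities from Slater's list hold, the series converging absolutely: $$\sum_{n=0}^{\infty}\frac{(-q;q)_{n+1}(q^3;q^3)_n}{(q;q)_n(q;q)_{2n+2}}q^{\frac{n^2+3n}{2}}=\frac{(-q;q)_\infty(q^3,q^{15},q^{18};q^{18})_\infty}{(q;q)_\infty},\tag{S.76}$$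 $$\sum_{n=0}^{\infty}\frac{(q^3;q^3)_n}{(q;q)_n(q;q)_{2n+2}}q^{n^2+3n}=\frac{(q^3,q^{24},q^{27};q^{27})_\infty}{(q;q)_\infty},\tag{S.90}$$ $$\sum_{n=0}^{\infty}\frac{(-q;q^2)_{n+1}(q^6;q^6)_n}{(q^2;q^2)_{2n+2}(q^2;q^2)_n}q^{n^2+4n}=\frac{(-q;q^2)_\infty(q^3,q^{33},q^{36};q^{36})_\infty}{(q^2;q^2)_\infty}.\tag{S.116}$$ -/

import Mathlib

/-- The finite `q`-shifted factorial `(a;q)_n = ∏_{k=0}^{n-1} (1 - a q^k)`, with `(a;q)_0 = 1`. -/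
noncomputable def qPoch (a q : ℂ) (n : ℕ) : ℂ :=
  ∏ k ∈ Finset.range n, (1 - a * q ^ k)

/-- The infinite `q`-shifted factorial `(a;q)_∞ = ∏_{k=0}^∞ (1 - a q^k)`. -/
noncomputable def qPochInf (a q : ℂ) : ℂ :=
  ∏' k : ℕ, (1 - a * q ^ k)

/-- For `|q| < 1` the product defining `(a;q)_∞` converges, so `qPochInf` is a genuine product. -/
theorem hasProd_qPochInf (a : ℂ) {q : ℂ} (hq : ‖q‖ < 1) :
    HasProd (fun k : ℕ => 1 - a * q ^ k) (qPochInf a q) := by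
  have h : Summable (fun k : ℕ => ‖-(a * q ^ k)‖) := by
    simp only [norm_neg, norm_mul, norm_pow]
    exact (summable_geometric_of_lt_one (norm_nonneg q) hq).mul_left _
  have hm := multipliable_one_add_of_summable h
  simp only [← sub_eq_add_neg] at hm
  exact hm.hasProd

/-!
Everything comes from one Bailey pair relative to `q ^ 3`, inserted in Bailey's lemma. Averaging the
finite Jacobi triple product `∑ j, (-1) ^ j q ^ (j (j - 1) / 2) [2 n + 3, n + j]_q x ^ j` over the
cube roots of unity `x` keeps only the exponents `j` divisible by `3`. On the product side `x = 1`
contributes `0` and the two primitive roots give a multiple of `(q ^ 3; q ^ 3)_n / (q; q)_n`.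
Pairing `j = -k` with `j = k + 3` turns this into the pair, whose `α` is supported on multiples
of `3`.

Bailey's lemma is a double series summed by rows with the `q`-Gauss sum. Its parameters are
written homogeneously, `a ^ n (u / a; q)_n = ∏ (a - u q ^ k)`, so that the limits `a → 0` needed
for Slater's identities are the plain substitution `a = 0`. After that substitution the `α`-side
is a theta series, evaluated by the Jacobi triple product.

The `q`-Gauss sum follows from its contiguous relation under `t ↦ t q`, iterated to `t q ^ N → 0`.
-/

open Asymptotics Filter Finset Topology

section Preliminaries

theorem choose_two_succ (n : ℕ) : (n + 1).choose 2 = n + n.choose 2 := by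
  rw [Nat.choose_succ_succ' n 1, Nat.choose_one_right]

theorem sq_eq_two_mul_choose_two_add (n : ℕ) : n ^ 2 = 2 * n.choose 2 + n := by
  induction n with
  | zero => rfl
  | succ n ih =>
    rw [choose_two_succ]
    linarith

theorem choose_two_three_mul (n : ℕ) : (3 * n).choose 2 = 9 * n.choose 2 + 3 * n := by
  induction n with
  | zero => rfl
  | succ n ih =>
    rw [mul_add_one, choose_two_succ, choose_two_succ, choose_two_succ, ih, choose_two_succ]
    ring

theorem exists_norm_le_of_tendsto {E : Type*} [NormedAddCommGroup E] {f : ℕ → E} {l : E}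
    (hf : Tendsto f atTop (𝓝 l)) : ∃ C : ℝ, 0 ≤ C ∧ ∀ n, ‖f n‖ ≤ C := by
  obtain ⟨C, hC⟩ := (isBigO_one_nat_atTop_iff (f := f)).mp (hf.isBigO_one ℝ)
  exact ⟨C, (norm_nonneg _).trans (hC 0), hC⟩

theorem mul_pow_mul_pow_ne_one {M : Type*} [Monoid M] {a q : M} (ha : ∀ n : ℕ, a * q ^ n ≠ 1)
    (k n : ℕ) : a * q ^ k * q ^ n ≠ 1 := by
  rw [mul_assoc, ← pow_add]
  exact ha (k + n)

theorem neg_one_pow_three_mul {R : Type*} [Ring R] (n : ℕ) : (-1 : R) ^ (3 * n) = (-1) ^ n := by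
  rw [pow_mul, Odd.neg_one_pow (by decide)]

section NormedDivisionRing

variable {K : Type*} [NormedDivisionRing K] {a q : K}

theorem norm_pow_lt_one (hq : ‖q‖ < 1) {n : ℕ} (hn : n ≠ 0) : ‖q ^ n‖ < 1 := by
  simpa only [norm_pow] using pow_lt_one₀ (norm_nonneg q) hq hn

theorem norm_pow_le_one (hq : ‖q‖ < 1) (n : ℕ) : ‖q ^ n‖ ≤ 1 := by
  simpa only [norm_pow] using pow_le_one₀ (norm_nonneg q) hq.le

theorem mul_pow_ne_one (hq : ‖q‖ < 1) (ha : ‖a‖ < 1) (n : ℕ) : a * q ^ n ≠ 1 := by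
  intro h
  have hlt : ‖a * q ^ n‖ < 1 := by
    rw [norm_mul]
    exact (mul_le_of_le_one_right (norm_nonneg a) (norm_pow_le_one hq n)).trans_lt ha
  rw [h, norm_one] at hlt
  exact lt_irrefl 1 hlt

theorem pow_ne_one_of_norm_lt_one (hq : ‖q‖ < 1) {n : ℕ} (hn : n ≠ 0) : q ^ n ≠ 1 := by
  simpa using mul_pow_ne_one hq (norm_pow_lt_one hq hn) 0

end NormedDivisionRing

end Preliminaries

section QPochhammer

theorem qPoch_zero (a q : ℂ) : qPoch a q 0 = 1 :=
  prod_range_zero _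

theorem qPoch_zero_left (q : ℂ) (n : ℕ) : qPoch 0 q n = 1 := by
  simp [qPoch]

theorem qPochInf_zero_left (q : ℂ) : qPochInf 0 q = 1 := by
  simp [qPochInf]

theorem qPoch_succ (a q : ℂ) (n : ℕ) : qPoch a q (n + 1) = qPoch a q n * (1 - a * q ^ n) :=
  prod_range_succ _ n

theorem qPoch_add (a q : ℂ) (m n : ℕ) :
    qPoch a q (m + n) = qPoch a q m * qPoch (a * q ^ m) q n := by
  simp only [qPoch, prod_range_add, pow_add, mul_assoc]

theorem qPoch_succ' (a q : ℂ) (n : ℕ) :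
    qPoch a q (n + 1) = (1 - a) * qPoch (a * q) q n := by
  rw [add_comm, qPoch_add, qPoch_succ, qPoch_zero, pow_zero, pow_one, mul_one, one_mul]

theorem qPoch_self_add_two (q : ℂ) (n : ℕ) :
    qPoch q q (n + 2) = (1 - q) * (1 - q ^ 2) * qPoch (q ^ 3) q n := by
  rw [qPoch_succ', qPoch_succ', ← sq, ← pow_succ, mul_assoc]

theorem qPoch_ne_zero {a q : ℂ} (ha : ∀ n : ℕ, a * q ^ n ≠ 1) (n : ℕ) : qPoch a q n ≠ 0 :=
  prod_ne_zero_iff.mpr fun k _ => sub_ne_zero.mpr (ha k).symm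

theorem qPoch_self_ne_zero {q : ℂ} (hq : ‖q‖ < 1) (n : ℕ) : qPoch q q n ≠ 0 :=
  qPoch_ne_zero (mul_pow_ne_one hq hq) n

theorem tendsto_qPoch (a : ℂ) {q : ℂ} (hq : ‖q‖ < 1) :
    Tendsto (qPoch a q) atTop (𝓝 (qPochInf a q)) :=
  (hasProd_qPochInf a hq).tendsto_prod_nat

theorem qPochInf_eq_qPoch_mul (a : ℂ) {q : ℂ} (hq : ‖q‖ < 1) (n : ℕ) :
    qPochInf a q = qPoch a q n * qPochInf (a * q ^ n) q := by
  refine tendsto_nhds_unique ((tendsto_qPoch a hq).comp (tendsto_add_atTop_nat n)) ?_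
  refine ((tendsto_qPoch (a * q ^ n) hq).const_mul (qPoch a q n)).congr fun m => ?_
  rw [Function.comp_apply, add_comm, qPoch_add]

theorem qPochInf_self_eq {q : ℂ} (hq : ‖q‖ < 1) :
    qPochInf q q = (1 - q) * (1 - q ^ 2) * qPochInf (q ^ 3) q := by
  rw [qPochInf_eq_qPoch_mul q hq 2, qPoch_self_add_two q 0, qPoch_zero, mul_one, ← pow_succ']

theorem qPochInf_ne_zero {a q : ℂ} (hq : ‖q‖ < 1) (ha : ∀ n : ℕ, a * q ^ n ≠ 1) :
    qPochInf a q ≠ 0 := by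
  have hsum : Summable fun k : ℕ => ‖-(a * q ^ k)‖ := by
    simpa only [norm_neg, norm_mul, norm_pow] using
      (summable_geometric_of_lt_one (norm_nonneg q) hq).mul_left ‖a‖
  have hprod := tprod_one_add_ne_zero_of_summable (f := fun k : ℕ => -(a * q ^ k))
    (fun k => by simpa only [← sub_eq_add_neg] using sub_ne_zero.mpr (ha k).symm) hsum
  simpa only [qPochInf, ← sub_eq_add_neg] using hprod

theorem exists_norm_qPoch_le (a : ℂ) {q : ℂ} (hq : ‖q‖ < 1) :
    ∃ C : ℝ, 0 ≤ C ∧ ∀ n, ‖qPoch a q n‖ ≤ C :=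
  exists_norm_le_of_tendsto (tendsto_qPoch a hq)

theorem exists_norm_inv_qPoch_le {a q : ℂ} (hq : ‖q‖ < 1) (ha : ∀ n : ℕ, a * q ^ n ≠ 1) :
    ∃ C : ℝ, 0 ≤ C ∧ ∀ n, ‖(qPoch a q n)⁻¹‖ ≤ C :=
  exists_norm_le_of_tendsto ((tendsto_qPoch a hq).inv₀ (qPochInf_ne_zero hq ha))

theorem exists_norm_inv_qPoch_mul_pow_le {a q : ℂ} (hq : ‖q‖ < 1) (ha : ∀ n : ℕ, a * q ^ n ≠ 1) :
    ∃ C : ℝ, 0 ≤ C ∧ ∀ k n, ‖(qPoch (a * q ^ k) q n)⁻¹‖ ≤ C := by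
  obtain ⟨C, hC₀, hC⟩ := exists_norm_qPoch_le a hq
  obtain ⟨D, hD₀, hD⟩ := exists_norm_inv_qPoch_le hq ha
  refine ⟨C * D, by positivity, fun k n => ?_⟩
  have hk : (qPoch (a * q ^ k) q n)⁻¹ = qPoch a q k * (qPoch a q (k + n))⁻¹ := by
    rw [qPoch_add, mul_inv, mul_inv_cancel_left₀ (qPoch_ne_zero ha k)]
  rw [hk, norm_mul]
  gcongr
  exacts [hC _, hD _]

end QPochhammer

section GaussianBinomial

/-- The Gaussian binomial coefficient `[n, k]_q`, defined by the `q`-Pascal recursion so that it is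
a polynomial in `q` and makes sense in every commutative semiring. -/
def gaussBinom {R : Type*} [CommSemiring R] (q : R) : ℕ → ℕ → R
  | _, 0 => 1
  | 0, _ + 1 => 0
  | n + 1, k + 1 => q ^ (k + 1) * gaussBinom q n (k + 1) + gaussBinom q n k

section CommSemiring

variable {R : Type*} [CommSemiring R] (q : R)

theorem gaussBinom_zero_right (n : ℕ) : gaussBinom q n 0 = 1 := by
  cases n <;> rfl

theorem gaussBinom_succ_succ (n k : ℕ) :
    gaussBinom q (n + 1) (k + 1) = q ^ (k + 1) * gaussBinom q n (k + 1) + gaussBinom q n k :=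
  rfl

theorem gaussBinom_eq_zero_of_lt : ∀ {n k : ℕ}, n < k → gaussBinom q n k = 0
  | 0, _ + 1, _ => rfl
  | n + 1, k + 1, h => by
    rw [gaussBinom_succ_succ, gaussBinom_eq_zero_of_lt (by omega),
      gaussBinom_eq_zero_of_lt (by omega), mul_zero, add_zero]

end CommSemiring

theorem gaussBinom_mul_qPoch (q : ℂ) (k m : ℕ) :
    gaussBinom q (k + m) k * (qPoch q q k * qPoch q q m) = qPoch q q (k + m) := by
  induction k generalizing m with
  | zero => simp only [gaussBinom_zero_right, qPoch_zero, zero_add, one_mul]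
  | succ k ihk =>
    induction m with
    | zero =>
      have h := ihk 0
      simp only [add_zero, qPoch_zero, mul_one] at h ⊢
      rw [gaussBinom_succ_succ, gaussBinom_eq_zero_of_lt q k.lt_succ_self, qPoch_succ]
      linear_combination (1 - q * q ^ k) * h
    | succ m ihm =>
      have h := ihk (m + 1)
      rw [show k + (m + 1) = k + 1 + m by ring, qPoch_succ q q m] at h
      rw [← add_assoc, gaussBinom_succ_succ, qPoch_succ q q (k + 1 + m), qPoch_succ q q m]
      rw [qPoch_succ q q k] at ihm ⊢
      linear_combination q ^ (k + 1) * (1 - q * q ^ m) * ihm + (1 - q * q ^ k) * h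

variable {q : ℂ}

theorem gaussBinom_eq_div (hq : ‖q‖ < 1) {k m n : ℕ} (h : k + m = n) :
    gaussBinom q n k = qPoch q q n / (qPoch q q k * qPoch q q m) := by
  subst h
  rw [eq_div_iff (mul_ne_zero (qPoch_self_ne_zero hq k) (qPoch_self_ne_zero hq m)),
    gaussBinom_mul_qPoch]

theorem exists_norm_gaussBinom_le (hq : ‖q‖ < 1) :
    ∃ C : ℝ, 0 ≤ C ∧ ∀ n k, ‖gaussBinom q n k‖ ≤ C := by
  obtain ⟨C, hC₀, hC⟩ := exists_norm_qPoch_le q hq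
  obtain ⟨D, hD₀, hD⟩ := exists_norm_inv_qPoch_le hq (mul_pow_ne_one hq hq)
  refine ⟨C * (D * D), by positivity, fun n k => ?_⟩
  rcases lt_or_ge n k with hnk | hkn
  · rw [gaussBinom_eq_zero_of_lt q hnk, norm_zero]
    positivity
  · obtain ⟨m, rfl⟩ := Nat.exists_eq_add_of_le hkn
    rw [gaussBinom_eq_div hq rfl, div_eq_mul_inv, mul_inv, norm_mul, norm_mul]
    gcongr
    exacts [hC _, hD _, hD _]

theorem tendsto_gaussBinom (hq : ‖q‖ < 1) {ι : Type*} {l : Filter ι} {k m : ι → ℕ}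
    (hk : Tendsto k l atTop) (hm : Tendsto m l atTop) :
    Tendsto (fun i => gaussBinom q (k i + m i) (k i)) l (𝓝 (qPochInf q q)⁻¹) := by
  have hlim := tendsto_qPoch q hq
  have hne : qPochInf q q ≠ 0 := qPochInf_ne_zero hq (mul_pow_ne_one hq hq)
  have h := (hlim.comp (tendsto_atTop_mono (fun i => Nat.le_add_right (k i) (m i)) hk)).div
    ((hlim.comp hk).mul (hlim.comp hm)) (mul_ne_zero hne hne)
  rw [div_mul_cancel_left₀ hne] at h
  exact h.congr fun i => (gaussBinom_eq_div hq rfl).symm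

end GaussianBinomial

section TripleProduct

/-- The general term of the Jacobi triple product series with `q = x * y`: it is
`(-x) ^ j * q ^ (j * (j - 1) / 2)` for every integer `j`, where for negative `j` the powers of
`x⁻¹` are absorbed into `y`, so that neither `x` nor `y` has to be invertible. -/
def thetaTerm {R : Type*} [CommRing R] (x y : R) : ℤ → R
  | Int.ofNat k => (-x) ^ k * (x * y) ^ k.choose 2
  | Int.negSucc k => (-y) ^ (k + 1) * (x * y) ^ (k + 1).choose 2

section CommRing

variable {R : Type*} [CommRing R]

theorem thetaTerm_natCast (x y : R) (k : ℕ) :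
    thetaTerm x y k = (-x) ^ k * (x * y) ^ k.choose 2 :=
  rfl

theorem thetaTerm_neg_natCast (x y : R) (k : ℕ) :
    thetaTerm x y (-k) = (-y) ^ k * (x * y) ^ k.choose 2 := by
  cases k with
  | zero => simpa using thetaTerm_natCast x y 0
  | succ k => rfl

theorem thetaTerm_sub_mul_pow {q x y : R} (hxy : x * y = q) (i n : ℕ) :
    thetaTerm x y (i - n) * q ^ (i + 1) = -y * q ^ n * thetaTerm x y (i + 1 - n) := by
  subst hxy
  rcases le_or_gt n i with h | h
  · obtain ⟨d, rfl⟩ := Nat.exists_eq_add_of_le h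
    rw [show ((n + d : ℕ) : ℤ) - n = (d : ℕ) by push_cast; ring,
      show ((n + d : ℕ) : ℤ) + 1 - n = (d + 1 : ℕ) by push_cast; ring,
      thetaTerm_natCast, thetaTerm_natCast, choose_two_succ]
    ring
  · obtain ⟨d, rfl⟩ := Nat.exists_eq_add_of_lt h
    rw [show (i : ℤ) - (i + d + 1 : ℕ) = -(d + 1 : ℕ) by push_cast; ring,
      show (i : ℤ) + 1 - (i + d + 1 : ℕ) = -(d : ℕ) by push_cast; ring,
      thetaTerm_neg_natCast, thetaTerm_neg_natCast, choose_two_succ]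
    ring

theorem sum_neg_pow_mul_gaussBinom (q x : R) (n : ℕ) :
    ∑ i ∈ range (n + 1), (-x) ^ i * q ^ i.choose 2 * gaussBinom q n i
      = ∏ k ∈ range n, (1 - x * q ^ k) := by
  induction n generalizing x with
  | zero => simp [gaussBinom_zero_right]
  | succ n ih =>
    have hterm : ∀ i, (-x) ^ (i + 1) * q ^ (i + 1).choose 2 * gaussBinom q (n + 1) (i + 1)
        = (-(x * q)) ^ (i + 1) * q ^ (i + 1).choose 2 * gaussBinom q n (i + 1)
          - x * ((-(x * q)) ^ i * q ^ i.choose 2 * gaussBinom q n i) := fun i => by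
      rw [gaussBinom_succ_succ, choose_two_succ]
      ring
    have hshift : ∑ i ∈ range (n + 1),
          (-(x * q)) ^ (i + 1) * q ^ (i + 1).choose 2 * gaussBinom q n (i + 1)
        = ∏ k ∈ range n, (1 - x * q * q ^ k) - 1 := by
      rw [sum_range_succ, gaussBinom_eq_zero_of_lt q n.lt_succ_self, ← ih, sum_range_succ' _ n]
      simp [gaussBinom_zero_right]
    rw [sum_range_succ', sum_congr rfl fun i _ => hterm i, sum_sub_distrib, hshift, ← mul_sum, ih,
      prod_range_succ']
    simp only [gaussBinom_zero_right, pow_succ', mul_assoc, pow_zero, Nat.choose_zero_succ]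
    ring

theorem sum_thetaTerm_mul_gaussBinom {q x y : R} (hxy : x * y = q) (m n : ℕ) :
    ∑ i ∈ range (m + n + 1), thetaTerm x y (i - n) * gaussBinom q (m + n) i
      = (∏ k ∈ range m, (1 - x * q ^ k)) * ∏ k ∈ range n, (1 - y * q ^ k) := by
  induction n with
  | zero =>
    simpa [thetaTerm_natCast, hxy] using sum_neg_pow_mul_gaussBinom q x m
  | succ n ih =>
    set S := ∑ i ∈ range (m + n + 1), thetaTerm x y (i - n) * gaussBinom q (m + n) i with hS
    have hterm : ∀ i : ℕ,
        thetaTerm x y ((i + 1 : ℕ) - (n + 1 : ℕ)) * gaussBinom q (m + n + 1) (i + 1)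
          = -y * q ^ n * (thetaTerm x y ((i + 1 : ℕ) - n) * gaussBinom q (m + n) (i + 1))
            + thetaTerm x y (i - n) * gaussBinom q (m + n) i := fun i => by
      rw [gaussBinom_succ_succ, show ((i + 1 : ℕ) : ℤ) - (n + 1 : ℕ) = i - n by push_cast; ring]
      push_cast
      linear_combination gaussBinom q (m + n) (i + 1) * thetaTerm_sub_mul_pow hxy i n
    have hshift : ∑ i ∈ range (m + n + 1),
          thetaTerm x y ((i + 1 : ℕ) - n) * gaussBinom q (m + n) (i + 1)
        = S - thetaTerm x y (-n) := by
      rw [hS, sum_range_succ, gaussBinom_eq_zero_of_lt q (Nat.lt_succ_self _), sum_range_succ']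
      simp [gaussBinom_zero_right]
    have hfirst : thetaTerm x y ((0 : ℕ) - (n + 1 : ℕ)) = -y * q ^ n * thetaTerm x y (-n) := by
      rw [Nat.cast_zero, zero_sub, thetaTerm_neg_natCast, thetaTerm_neg_natCast, choose_two_succ,
        hxy]
      ring
    rw [← add_assoc, sum_range_succ', sum_congr rfl fun i _ => hterm i, sum_add_distrib,
      ← mul_sum, hshift, hfirst, gaussBinom_zero_right, prod_range_succ, ← mul_assoc, ← ih]
    ring

end CommRing

theorem summable_pow_mul_pow_choose_two (x : ℂ) {q : ℂ} (hq : ‖q‖ < 1) :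
    Summable fun k : ℕ => x ^ k * q ^ k.choose 2 := by
  have hlim : Tendsto (fun k : ℕ => ‖x * q ^ k‖) atTop (𝓝 0) := by
    simpa using ((tendsto_pow_atTop_nhds_zero_of_norm_lt_one hq).const_mul x).norm
  refine summable_of_ratio_norm_eventually_le (r := 1 / 2) (by norm_num) ?_
  filter_upwards [hlim.eventually_le_const (show (0 : ℝ) < 1 / 2 by norm_num)] with k hk
  rw [choose_two_succ, show x ^ (k + 1) * q ^ (k + k.choose 2)
    = x * q ^ k * (x ^ k * q ^ k.choose 2) by ring, norm_mul]
  gcongr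

theorem summable_thetaTerm {x y : ℂ} (hxy : ‖x * y‖ < 1) : Summable (thetaTerm x y) :=
  Summable.of_nat_of_neg (summable_pow_mul_pow_choose_two (-x) hxy)
    (by simpa only [thetaTerm_neg_natCast] using summable_pow_mul_pow_choose_two (-y) hxy)

theorem tsum_thetaTerm_mul_gaussBinom {q x y : ℂ} (hxy : x * y = q) (n : ℕ) :
    ∑' j : ℤ, (if -(n : ℤ) ≤ j then
        thetaTerm x y j * gaussBinom q (n + n) (j + n).toNat else 0)
      = qPoch x q n * qPoch y q n := by
  have hinj : Function.Injective fun i : ℕ => (i : ℤ) - n := fun i j hij => by simpa using hij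
  have hsupp : Function.support (fun j : ℤ => if -(n : ℤ) ≤ j then
      thetaTerm x y j * gaussBinom q (n + n) (j + n).toNat else 0)
        ⊆ Set.range fun i : ℕ => (i : ℤ) - n := fun j hj => by
    have hnj : -(n : ℤ) ≤ j := by
      by_contra h
      exact hj (if_neg h)
    exact ⟨(j + n).toNat, by simp only; omega⟩
  have hvanish : ∀ i ∉ range (n + n + 1), thetaTerm x y (i - n) * gaussBinom q (n + n) i = 0 :=
    fun i hi => by
      have hlt : n + n < i := not_lt.mp (mem_range.not.mp hi)
      rw [gaussBinom_eq_zero_of_lt q hlt, mul_zero]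
  calc _ = ∑' i : ℕ, thetaTerm x y (i - n) * gaussBinom q (n + n) i := by
        rw [← hinj.tsum_eq hsupp]
        simp
    _ = _ := (tsum_eq_sum hvanish).trans (sum_thetaTerm_mul_gaussBinom hxy n n)

theorem hasSum_thetaTerm {q x y : ℂ} (hq : ‖q‖ < 1) (hxy : x * y = q) :
    HasSum (thetaTerm x y) (qPochInf x q * qPochInf y q * qPochInf q q) := by
  have hsum : Summable (thetaTerm x y) := summable_thetaTerm (hxy ▸ hq)
  obtain ⟨C, hC₀, hC⟩ := exists_norm_gaussBinom_le hq
  let f : ℕ → ℤ → ℂ := fun n j =>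
    if -(n : ℤ) ≤ j then thetaTerm x y j * gaussBinom q (n + n) (j + n).toNat else 0
  have hfinite : ∀ n, ∑' j, f n j = qPoch x q n * qPoch y q n := fun n =>
    tsum_thetaTerm_mul_gaussBinom hxy n
  have hterm : ∀ j, Tendsto (f · j) atTop (𝓝 (thetaTerm x y j * (qPochInf q q)⁻¹)) := fun j => by
    have hlim : Tendsto (fun n : ℕ => gaussBinom q ((j + n).toNat + (n - j).toNat) (j + n).toNat)
        atTop (𝓝 (qPochInf q q)⁻¹) :=
      tendsto_gaussBinom hq (tendsto_atTop_atTop.mpr fun b => ⟨b + j.natAbs, by omega⟩)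
        (tendsto_atTop_atTop.mpr fun b => ⟨b + j.natAbs, by omega⟩)
    refine (hlim.const_mul (thetaTerm x y j)).congr' ?_
    filter_upwards [eventually_ge_atTop j.natAbs] with n hn
    rw [show (j + n).toNat + (n - j).toNat = n + n by omega]
    exact (if_pos (by omega)).symm
  have htannery := tendsto_tsum_of_dominated_convergence (hsum.norm.mul_right C) hterm
    (Eventually.of_forall fun n j => ?_)
  · simp only [hfinite, tsum_mul_right] at htannery
    have h := tendsto_nhds_unique htannery ((tendsto_qPoch x hq).mul (tendsto_qPoch y hq))
    rw [← div_eq_mul_inv, div_eq_iff (qPochInf_ne_zero hq (mul_pow_ne_one hq hq))] at h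
    exact h ▸ hsum.hasSum
  · simp only [f]
    split_ifs
    · rw [norm_mul]
      gcongr
      exact hC _ _
    · rw [norm_zero]
      positivity

theorem hasSum_thetaTerm_fold {q x y : ℂ} (hq : ‖q‖ < 1) (hxy : x * y = q) :
    HasSum (fun r : ℕ =>
        (-1) ^ r * (x ^ r * q ^ r.choose 2 - y ^ (r + 1) * q ^ (r + 1).choose 2))
      (qPochInf x q * qPochInf y q * qPochInf q q) := by
  refine (hasSum_thetaTerm hq hxy).nat_add_neg_add_one.congr_fun fun r => ?_
  have hneg := thetaTerm_neg_natCast x y (r + 1)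
  push_cast at hneg
  rw [hneg, thetaTerm_natCast, hxy, neg_pow x, neg_pow y]
  ring

end TripleProduct

section Dissection

theorem sum_pow_zpow_of_isPrimitiveRoot {K : Type*} [Field K] {ω : K} {d : ℕ}
    (hω : IsPrimitiveRoot ω d) (j : ℤ) :
    ∑ r ∈ range d, (ω ^ r) ^ j = if (d : ℤ) ∣ j then (d : K) else 0 := by
  have hcomm : ∀ r : ℕ, (ω ^ r) ^ j = (ω ^ j) ^ r := fun r => by
    rw [← zpow_natCast, ← zpow_natCast, zpow_comm]
  simp only [hcomm]
  split_ifs with hj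
  · simp [(hω.zpow_eq_one_iff_dvd j).mpr hj]
  · rw [geom_sum_eq (mt (hω.zpow_eq_one_iff_dvd j).mp hj), ← hcomm, hω.pow_eq_one, one_zpow,
      sub_self, zero_div]

theorem thetaTerm_mul_inv_mul {K : Type*} [Field K] {ζ : K} (hζ : ζ ≠ 0) (x y : K) (j : ℤ) :
    thetaTerm (ζ * x) (ζ⁻¹ * y) j = ζ ^ j * thetaTerm x y j := by
  have hprod : ζ * x * (ζ⁻¹ * y) = x * y := by
    field_simp
  obtain ⟨k, rfl | rfl⟩ := j.eq_nat_or_neg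
  · rw [thetaTerm_natCast, thetaTerm_natCast, hprod, zpow_natCast, neg_mul_eq_mul_neg, mul_pow,
      mul_assoc]
  · rw [thetaTerm_neg_natCast, thetaTerm_neg_natCast, hprod, zpow_neg, zpow_natCast,
      neg_mul_eq_mul_neg, mul_pow, inv_pow, mul_assoc]

/-- Averaging the finite triple product over the `d`-th roots of unity keeps only every `d`-th
term. -/
theorem mul_sum_dvd_thetaTerm_mul_gaussBinom {q x y ω : ℂ} {d : ℕ} (hω : IsPrimitiveRoot ω d)
    (hxy : x * y = q) (m n : ℕ) :
    d * ∑ i ∈ range (m + n + 1) with (d : ℤ) ∣ (i : ℕ) - n,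
        thetaTerm x y (i - n) * gaussBinom q (m + n) i
      = ∑ r ∈ range d, qPoch (ω ^ r * x) q m * qPoch ((ω ^ r)⁻¹ * y) q n := by
  rcases d.eq_zero_or_pos with rfl | hd
  · simp
  have hne : ∀ r, ω ^ r ≠ 0 := fun r => pow_ne_zero r (hω.ne_zero hd.ne')
  calc _ = ∑ i ∈ range (m + n + 1), (∑ r ∈ range d, (ω ^ r) ^ ((i : ℤ) - n))
        * (thetaTerm x y (i - n) * gaussBinom q (m + n) i) := by
        simp only [sum_pow_zpow_of_isPrimitiveRoot hω, ite_mul, zero_mul, mul_sum, sum_filter,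
          mul_ite, mul_zero]
    _ = ∑ r ∈ range d, ∑ i ∈ range (m + n + 1),
        thetaTerm (ω ^ r * x) ((ω ^ r)⁻¹ * y) (i - n) * gaussBinom q (m + n) i := by
        simp only [sum_mul, thetaTerm_mul_inv_mul (hne _), mul_assoc]
        rw [sum_comm]
    _ = _ := sum_congr rfl fun r _ => sum_thetaTerm_mul_gaussBinom
        (by rw [← hxy, mul_mul_mul_comm, mul_inv_cancel₀ (hne r), one_mul]) m n

end Dissection

section CubicBaileyPair

/-- `(α, β)` is a Bailey pair relative to `a`, for the base `q`: the relation that Bailey's lemma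
turns into an identity between a series in `β` and a series in `α`. -/
def IsBaileyPair (a q : ℂ) (α β : ℕ → ℂ) : Prop :=
  ∀ n, β n = ∑ k ∈ range (n + 1), α k / (qPoch q q (n - k) * qPoch (a * q) q (n + k))

/-- The sequence `α` of the cubic Bailey pair relative to `q ^ 3`, supported on the multiples
of `3`. -/
noncomputable def cubicAlpha (q : ℂ) (k : ℕ) : ℂ :=
  if 3 ∣ k then (-1) ^ k * q ^ (k + 1).choose 2 * (1 - q ^ (2 * k + 3)) / (1 - q ^ 3) else 0

/-- The sequence `β` of the cubic Bailey pair relative to `q ^ 3`, in closed form. -/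
noncomputable def cubicBeta (q : ℂ) (n : ℕ) : ℂ :=
  qPoch (q ^ 3) (q ^ 3) n / (qPoch q q n * qPoch (q ^ 3) q (2 * n))

theorem qPoch_cube {ω : ℂ} (hω : ω ^ 2 + ω + 1 = 0) (a q : ℂ) (n : ℕ) :
    qPoch (a ^ 3) (q ^ 3) n = qPoch a q n * qPoch (ω * a) q n * qPoch (ω ^ 2 * a) q n := by
  simp only [qPoch, ← prod_mul_distrib]
  refine prod_congr rfl fun k _ => ?_
  linear_combination (a * q ^ k - ω * (a * q ^ k) ^ 2 + (ω - 1) * (a * q ^ k) ^ 3) * hω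

/-- For `d = 3` the trivial cube root of unity contributes nothing, since `(1;q)_{n+3} = 0`. -/
theorem sum_cubeRoot_qPoch {ω : ℂ} (hω : ω ^ 2 + ω + 1 = 0) (q : ℂ) (n : ℕ) :
    qPoch q q n * ∑ r ∈ range 3, qPoch (ω ^ r * 1) q (n + 3) * qPoch ((ω ^ r)⁻¹ * q) q n
      = 3 * (1 - q ^ (2 * n + 3)) * qPoch (q ^ 3) (q ^ 3) n := by
  have hω₃ : ω ^ 3 = 1 := by linear_combination (ω - 1) * hω
  have hinv : ω⁻¹ = ω ^ 2 := inv_eq_of_mul_eq_one_right (by rw [← pow_succ', hω₃])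
  have hinv' : (ω ^ 2)⁻¹ = ω := by rw [← hinv, inv_inv]
  have hsplit : ∀ z : ℂ, qPoch z q (n + 3)
      = (1 - z) * (1 - z * q ^ (n + 1)) * (1 - z * q ^ (n + 2)) * qPoch (z * q) q n := fun z => by
    rw [qPoch_succ' z, qPoch_succ, qPoch_succ]
    ring
  rw [qPoch_cube hω, sum_range_succ, sum_range_succ, sum_range_one]
  simp only [hsplit, pow_zero, pow_one, mul_one, hinv, hinv']
  linear_combination qPoch q q n * qPoch (ω * q) q n * qPoch (ω ^ 2 * q) q n
    * ((ω ^ 2 - ω) * (q ^ (n + 1) + q ^ (n + 2))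
      - (ω ^ 4 - ω ^ 3 - ω ^ 2 + 3 * ω - 3) * q ^ (2 * n + 3) - 1) * hω

theorem thetaTerm_one_neg_add_thetaTerm_one (q : ℂ) (k : ℕ) :
    thetaTerm 1 q (-k) + thetaTerm 1 q (k + 3 : ℕ)
      = (-1) ^ k * q ^ (k + 1).choose 2 * (1 - q ^ (2 * k + 3)) := by
  rw [thetaTerm_natCast, thetaTerm_neg_natCast]
  simp only [choose_two_succ]
  rw [neg_pow q]
  ring

theorem sum_range_two_mul_add_four {M : Type*} [AddCommMonoid M] (f : ℕ → M) (n : ℕ) :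
    ∑ i ∈ range (2 * n + 4), f i
      = ∑ k ∈ range (n + 1), (f (n - k) + f (n + 3 + k)) + (f (n + 1) + f (n + 2)) := by
  have hrefl : ∑ i ∈ range (n + 1), f i = ∑ k ∈ range (n + 1), f (n - k) :=
    (sum_range_reflect f (n + 1)).symm
  have hshift : ∑ i ∈ range (n + 3), f (n + 1 + i)
      = ∑ k ∈ range (n + 1), f (n + 3 + k) + (f (n + 1) + f (n + 2)) := by
    rw [sum_range_succ', sum_range_succ']
    simp [add_assoc, add_comm, add_left_comm]
  rw [show 2 * n + 4 = n + 1 + (n + 3) by ring, sum_range_add, hrefl, hshift, sum_add_distrib,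
    add_assoc]

theorem qPoch_self_two_mul_add_three (q : ℂ) (n : ℕ) :
    qPoch q q (2 * n + 3)
      = (1 - q) * (1 - q ^ 2) * (qPoch (q ^ 3) q (2 * n) * (1 - q ^ (2 * n + 3))) := by
  rw [show 2 * n + 3 = 2 * n + 1 + 2 by ring, qPoch_self_add_two, qPoch_succ]
  ring

theorem qPoch_self_add_three (q : ℂ) (m : ℕ) :
    qPoch q q (m + 3) = (1 - q) * (1 - q ^ 2) * (1 - q ^ 3) * qPoch (q ^ 3 * q) q m := by
  rw [show m + 3 = m + 1 + 2 by ring, qPoch_self_add_two, qPoch_succ']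
  ring

theorem thetaTerm_pair_mul_gaussBinom {q : ℂ} (hq : ‖q‖ < 1) {k n : ℕ} (hk : k ≤ n) (h3 : 3 ∣ k) :
    thetaTerm 1 q (-k) * gaussBinom q (n + 3 + n) (n - k)
        + thetaTerm 1 q (k + 3 : ℕ) * gaussBinom q (n + 3 + n) (n + 3 + k)
      = qPoch (q ^ 3) q (2 * n) * (1 - q ^ (2 * n + 3))
        * (cubicAlpha q k / (qPoch q q (n - k) * qPoch (q ^ 3 * q) q (n + k))) := by
  have hne : ∀ m : ℕ, m ≠ 0 → 1 - q ^ m ≠ 0 := fun m hm =>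
    sub_ne_zero.mpr (pow_ne_one_of_norm_lt_one hq hm).symm
  have h₁ := hne 1 one_ne_zero
  have h₂ := hne 2 two_ne_zero
  rw [pow_one] at h₁
  have hlow : gaussBinom q (n + 3 + n) (n - k)
      = qPoch q q (2 * n + 3) / (qPoch q q (n - k) * qPoch q q (n + k + 3)) := by
    rw [gaussBinom_eq_div hq (by omega : n - k + (n + k + 3) = n + 3 + n)]
    ring_nf
  have hhigh : gaussBinom q (n + 3 + n) (n + 3 + k)
      = qPoch q q (2 * n + 3) / (qPoch q q (n - k) * qPoch q q (n + k + 3)) := by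
    rw [gaussBinom_eq_div hq (by omega : n + 3 + k + (n - k) = n + 3 + n)]
    ring_nf
  rw [hlow, hhigh, ← add_mul, thetaTerm_one_neg_add_thetaTerm_one, cubicAlpha, if_pos h3,
    qPoch_self_two_mul_add_three, qPoch_self_add_three]
  field_simp

theorem sum_cubicAlpha_div {q : ℂ} (hq : ‖q‖ < 1) (n : ℕ) :
    qPoch (q ^ 3) q (2 * n) * (1 - q ^ (2 * n + 3)) * ∑ k ∈ range (n + 1),
        cubicAlpha q k / (qPoch q q (n - k) * qPoch (q ^ 3 * q) q (n + k))
      = ∑ i ∈ range (n + 3 + n + 1) with ((3 : ℕ) : ℤ) ∣ (i : ℕ) - n,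
        thetaTerm 1 q (i - n) * gaussBinom q (n + 3 + n) i := by
  rw [mul_sum, sum_filter, show n + 3 + n + 1 = 2 * n + 4 by ring, sum_range_two_mul_add_four,
    if_neg (by omega), if_neg (by omega), add_zero, add_zero]
  refine sum_congr rfl fun k hk => ?_
  have hkn : k ≤ n := Nat.lt_succ_iff.mp (mem_range.mp hk)
  have hlow : ((n - k : ℕ) : ℤ) - n = -k := by omega
  have hhigh : ((n + 3 + k : ℕ) : ℤ) - n = (k + 3 : ℕ) := by omega
  rw [hlow, hhigh]
  by_cases h3 : 3 ∣ k
  · rw [if_pos (by omega), if_pos (by omega), thetaTerm_pair_mul_gaussBinom hq hkn h3]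
  · rw [if_neg (by omega), if_neg (by omega), cubicAlpha, if_neg h3]
    simp

theorem isBaileyPair_cubic {q : ℂ} (hq : ‖q‖ < 1) :
    IsBaileyPair (q ^ 3) q (cubicAlpha q) (cubicBeta q) := fun n => by
  have hω := Complex.isPrimitiveRoot_exp 3 three_ne_zero
  set ω := Complex.exp (2 * Real.pi * Complex.I / (3 : ℕ))
  have hω₀ : ω ^ 2 + ω + 1 = 0 := by
    have h := hω.geom_sum_eq_zero (by norm_num)
    simp only [sum_range_succ, range_zero, sum_empty] at h
    linear_combination h
  have hA : qPoch (q ^ 3) q (2 * n) ≠ 0 :=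
    qPoch_ne_zero (mul_pow_ne_one hq (norm_pow_lt_one hq three_ne_zero)) _
  have hB : 1 - q ^ (2 * n + 3) ≠ 0 :=
    sub_ne_zero.mpr (pow_ne_one_of_norm_lt_one hq (by omega)).symm
  have hC := qPoch_self_ne_zero hq n
  have hdissect := mul_sum_dvd_thetaTerm_mul_gaussBinom hω (one_mul q) (n + 3) n
  have hvalue := sum_cubeRoot_qPoch hω₀ q n
  rw [← hdissect, ← sum_cubicAlpha_div hq] at hvalue
  rw [cubicBeta, div_eq_iff (mul_ne_zero hC hA)]
  refine mul_left_cancel₀ (mul_ne_zero three_ne_zero hB) ?_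
  push_cast at hvalue
  linear_combination -hvalue

end CubicBaileyPair

section GaussSum

/-- The homogeneous `q`-shifted factorial `∏ k < n, (a - u * q ^ k)`. It equals `a ^ n (u / a; q)_n`
when `a ≠ 0`, and the limit of that expression as `a → 0` when `a = 0`. -/
def homQPoch (a u q : ℂ) (n : ℕ) : ℂ :=
  ∏ k ∈ range n, (a - u * q ^ k)

theorem homQPoch_zero (a u q : ℂ) : homQPoch a u q 0 = 1 :=
  prod_range_zero _

theorem homQPoch_succ (a u q : ℂ) (n : ℕ) :
    homQPoch a u q (n + 1) = homQPoch a u q n * (a - u * q ^ n) :=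
  prod_range_succ _ n

theorem homQPoch_add (a u q : ℂ) (m n : ℕ) :
    homQPoch a u q (m + n) = homQPoch a u q m * homQPoch a (u * q ^ m) q n := by
  simp only [homQPoch, prod_range_add, pow_add, mul_assoc]

theorem homQPoch_one_left (u q : ℂ) (n : ℕ) : homQPoch 1 u q n = qPoch u q n :=
  rfl

theorem homQPoch_zero_left (q : ℂ) (n : ℕ) :
    homQPoch 0 1 q n = (-1) ^ n * q ^ n.choose 2 := by
  induction n with
  | zero => simp [homQPoch_zero]
  | succ n ih =>
    rw [homQPoch_succ, ih, choose_two_succ]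
    ring

variable {q : ℂ}

theorem exists_norm_homQPoch_le (hq : ‖q‖ < 1) {a : ℂ} {ρ : ℝ} (hρ : 0 < ρ) (ha : ‖a‖ ≤ ρ)
    (R : ℝ) :
    ∃ K : ℝ, 0 ≤ K ∧ ∀ w : ℂ, ‖w‖ ≤ R → ∀ n, ‖homQPoch a w q n‖ ≤ K * ρ ^ n := by
  refine ⟨Real.exp (R / ρ * (1 - ‖q‖)⁻¹), (Real.exp_pos _).le, fun w hw n => ?_⟩
  have hR : 0 ≤ R := (norm_nonneg w).trans hw
  have hfactor : ∀ k, ‖a - w * q ^ k‖ ≤ ρ * (1 + R / ρ * ‖q‖ ^ k) := fun k =>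
    calc ‖a - w * q ^ k‖ ≤ ‖a‖ + ‖w‖ * ‖q‖ ^ k := by
          simpa only [norm_mul, norm_pow] using norm_sub_le a (w * q ^ k)
      _ ≤ ρ + R * ‖q‖ ^ k := by gcongr
      _ = ρ * (1 + R / ρ * ‖q‖ ^ k) := by field_simp
  calc ‖homQPoch a w q n‖ ≤ ∏ k ∈ range n, ρ * (1 + R / ρ * ‖q‖ ^ k) := by
        rw [homQPoch, norm_prod]
        exact prod_le_prod (fun k _ => norm_nonneg _) fun k _ => hfactor k
    _ = (∏ k ∈ range n, (1 + R / ρ * ‖q‖ ^ k)) * ρ ^ n := by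
        rw [prod_mul_distrib, prod_const, card_range, mul_comm]
    _ ≤ Real.exp (∑ k ∈ range n, R / ρ * ‖q‖ ^ k) * ρ ^ n := by
        gcongr
        exact Real.prod_one_add_le_exp_sum _ fun k => by positivity
    _ ≤ Real.exp (R / ρ * (1 - ‖q‖)⁻¹) * ρ ^ n := by
        rw [← mul_sum]
        gcongr
        rw [← tsum_geometric_of_lt_one (norm_nonneg q) hq]
        exact (summable_geometric_of_lt_one (norm_nonneg q) hq).sum_le_tsum _
          fun k _ => by positivity

variable {A B t : ℂ}

theorem exists_norm_homQPoch_mul_le (hq : ‖q‖ < 1) (h : ‖A * B * t‖ < 1) (u v : ℂ) :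
    ∃ K ρ : ℝ, 0 ≤ K ∧ 0 ≤ ρ ∧ ρ < 1 ∧ ∀ w z : ℂ, ‖w‖ ≤ ‖u‖ → ‖z‖ ≤ ‖v‖ → ∀ n,
      ‖homQPoch A w q n * homQPoch B z q n * t ^ n‖ ≤ K * ρ ^ n := by
  have hlim : Tendsto (fun ε : ℝ => (‖A‖ + ε) * (‖B‖ + ε) * ‖t‖) (𝓝[>] 0) (𝓝 ‖A * B * t‖) := by
    refine Tendsto.mono_left ?_ nhdsWithin_le_nhds
    simpa using Continuous.tendsto
      (f := fun ε : ℝ => (‖A‖ + ε) * (‖B‖ + ε) * ‖t‖) (by fun_prop) 0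
  obtain ⟨ε, hlt, hε : 0 < ε⟩ := ((hlim.eventually_lt_const h).and self_mem_nhdsWithin).exists
  obtain ⟨K, hK₀, hK⟩ := exists_norm_homQPoch_le hq (a := A) (ρ := ‖A‖ + ε) (by positivity)
    (by linarith) ‖u‖
  obtain ⟨L, hL₀, hL⟩ := exists_norm_homQPoch_le hq (a := B) (ρ := ‖B‖ + ε) (by positivity)
    (by linarith) ‖v‖
  refine ⟨K * L, _, by positivity, by positivity, hlt, fun w z hw hz n => ?_⟩
  calc ‖homQPoch A w q n * homQPoch B z q n * t ^ n‖
      ≤ K * (‖A‖ + ε) ^ n * (L * (‖B‖ + ε) ^ n) * ‖t‖ ^ n := by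
        rw [norm_mul, norm_mul, norm_pow]
        gcongr
        exacts [hK w hw n, hL z hz n]
    _ = K * L * ((‖A‖ + ε) * (‖B‖ + ε) * ‖t‖) ^ n := by
        rw [mul_pow, mul_pow]
        ring

/-- The general term of the `q`-Gauss sum `₂φ₁(u / A, v / B; u v t; q, A B t)`, written so that `A`
and `B` may vanish. -/
noncomputable def gaussTerm (A B u v t q : ℂ) (m : ℕ) : ℂ :=
  homQPoch A u q m * homQPoch B v q m * t ^ m / (qPoch q q m * qPoch (u * v * t) q m)

theorem gaussTerm_zero (A B u v t q : ℂ) : gaussTerm A B u v t q 0 = 1 := by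
  simp [gaussTerm, homQPoch_zero, qPoch_zero]

variable {u v c : ℂ}

theorem exists_norm_gaussTerm_le (hq : ‖q‖ < 1) (hABt : ‖A * B * t‖ < 1)
    (hc : ∀ n : ℕ, c * q ^ n ≠ 1) (u v : ℂ) :
    ∃ K ρ : ℝ, 0 ≤ K ∧ 0 ≤ ρ ∧ ρ < 1 ∧ ∀ (w z s : ℂ) (N : ℕ), ‖w‖ ≤ ‖u‖ → ‖z‖ ≤ ‖v‖ → ‖s‖ ≤ ‖t‖ →
      w * z * s = c * q ^ N → ∀ m, ‖gaussTerm A B w z s q m‖ ≤ K * ρ ^ m := by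
  obtain ⟨K, ρ, hK₀, hρ₀, hρ₁, hK⟩ := exists_norm_homQPoch_mul_le hq hABt u v
  obtain ⟨C, hC₀, hC⟩ := exists_norm_inv_qPoch_le hq (mul_pow_ne_one hq hq)
  obtain ⟨D, hD₀, hD⟩ := exists_norm_inv_qPoch_mul_pow_le hq hc
  refine ⟨K * (C * D), ρ, by positivity, hρ₀, hρ₁, fun w z s N hw hz hs hwzs m => ?_⟩
  have hnum : ‖homQPoch A w q m * homQPoch B z q m * s ^ m‖ ≤ K * ρ ^ m := by
    refine le_trans ?_ (hK w z hw hz m)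
    simp only [norm_mul, norm_pow]
    gcongr
  calc ‖gaussTerm A B w z s q m‖ ≤ K * ρ ^ m * (C * D) := by
        rw [gaussTerm, hwzs, div_eq_mul_inv, mul_inv, norm_mul, norm_mul (qPoch q q m)⁻¹]
        gcongr
        exacts [hC m, hD N m]
    _ = K * (C * D) * ρ ^ m := by ring

theorem gaussTerm_contiguous (hq : ‖q‖ < 1) (hc : ∀ n : ℕ, u * v * t * q ^ n ≠ 1) (m : ℕ) :
    (1 - u * v * t) * (1 - A * B * t) * gaussTerm A B u v t q m
        - (1 - A * v * t) * (1 - B * u * t) * gaussTerm A B u v (t * q) q m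
      = (1 - u * v * t) * ((1 - q ^ m) * gaussTerm A B u v t q m
        - (1 - q ^ (m + 1)) * gaussTerm A B u v t q (m + 1)) := by
  have hQ : 1 - q ^ (m + 1) ≠ 0 :=
    sub_ne_zero.mpr (pow_ne_one_of_norm_lt_one hq m.succ_ne_zero).symm
  have hC : ∀ n : ℕ, 1 - u * v * t * q ^ n ≠ 0 := fun n => sub_ne_zero.mpr (hc n).symm
  have hC₀ : 1 - u * v * t ≠ 0 := by simpa using hC 0
  have hCm := hC m
  have hqm := qPoch_self_ne_zero hq m
  have hcm := qPoch_ne_zero hc m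
  have hshift : qPoch (u * v * (t * q)) q m
      = qPoch (u * v * t) q m * (1 - u * v * t * q ^ m) / (1 - u * v * t) := by
    rw [eq_div_iff hC₀, ← qPoch_succ, qPoch_succ', mul_comm, mul_assoc (u * v)]
  simp only [gaussTerm, homQPoch_succ, qPoch_succ, hshift, mul_pow, ← pow_succ']
  field_simp
  ring

theorem summable_gaussTerm (hq : ‖q‖ < 1) (hc : ∀ n : ℕ, u * v * t * q ^ n ≠ 1)
    (hABt : ‖A * B * t‖ < 1) : Summable (gaussTerm A B u v t q) := by
  obtain ⟨K, ρ, -, hρ₀, hρ₁, hK⟩ := exists_norm_gaussTerm_le hq hABt hc u v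
  exact ((summable_geometric_of_lt_one hρ₀ hρ₁).mul_left K).of_norm_bounded
    (hK u v t 0 le_rfl le_rfl le_rfl (by simp))

theorem tsum_gaussTerm_contiguous (hq : ‖q‖ < 1) (hc : ∀ n : ℕ, u * v * t * q ^ n ≠ 1)
    (hABt : ‖A * B * t‖ < 1) :
    (1 - u * v * t) * (1 - A * B * t) * ∑' m, gaussTerm A B u v t q m
      = (1 - A * v * t) * (1 - B * u * t) * ∑' m, gaussTerm A B u v (t * q) q m := by
  have hsum := summable_gaussTerm hq hc hABt
  have hsum' : Summable (gaussTerm A B u v (t * q) q) := by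
    refine summable_gaussTerm hq (fun n => ?_) ?_
    · simpa only [pow_one, mul_assoc] using mul_pow_mul_pow_ne_one hc 1 n
    · rw [← mul_assoc, norm_mul]
      exact mul_lt_one_of_nonneg_of_lt_one_left (norm_nonneg _) hABt hq.le
  let f : ℕ → ℂ := fun m => (1 - q ^ m) * gaussTerm A B u v t q m
  have hf : Tendsto f atTop (𝓝 0) := by
    simpa using ((tendsto_pow_atTop_nhds_zero_of_norm_lt_one hq).const_sub 1).mul
      hsum.tendsto_atTop_zero
  have htelescope : Tendsto (fun n => ∑ m ∈ range n, (1 - u * v * t) * (f m - f (m + 1))) atTop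
      (𝓝 0) := by
    simp only [← mul_sum, sum_range_sub']
    simpa [f] using (hf.const_sub (f 0)).const_mul (1 - u * v * t)
  have hdiff := ((hsum.mul_left ((1 - u * v * t) * (1 - A * B * t))).hasSum.sub
    (hsum'.mul_left ((1 - A * v * t) * (1 - B * u * t))).hasSum).tendsto_sum_nat
  simp only [gaussTerm_contiguous hq hc, tsum_mul_left] at hdiff
  exact sub_eq_zero.mp (tendsto_nhds_unique hdiff htelescope)

theorem tsum_gaussTerm_iterate (hq : ‖q‖ < 1) (hc : ∀ n : ℕ, u * v * t * q ^ n ≠ 1)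
    (hABt : ‖A * B * t‖ < 1) (N : ℕ) :
    qPoch (u * v * t) q N * qPoch (A * B * t) q N * ∑' m, gaussTerm A B u v t q m
      = qPoch (A * v * t) q N * qPoch (B * u * t) q N
        * ∑' m, gaussTerm A B u v (t * q ^ N) q m := by
  induction N with
  | zero => simp [qPoch_zero]
  | succ N ih =>
    have hstep := tsum_gaussTerm_contiguous (A := A) (B := B) (u := u) (v := v) (t := t * q ^ N) hq
      (fun n => by simpa only [mul_assoc] using mul_pow_mul_pow_ne_one hc N n)
      (by
        rw [← mul_assoc, norm_mul]
        exact mul_lt_one_of_nonneg_of_lt_one_left (norm_nonneg _) hABt (norm_pow_le_one hq N))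
    simp only [← mul_assoc] at hstep
    simp only [qPoch_succ, pow_succ, ← mul_assoc]
    linear_combination (1 - u * v * t * q ^ N) * (1 - A * B * t * q ^ N) * ih
      + qPoch (A * v * t) q N * qPoch (B * u * t) q N * hstep

theorem gaussTerm_zero_argument (A B u v q : ℂ) (m : ℕ) :
    gaussTerm A B u v 0 q m = if m = 0 then 1 else 0 := by
  split_ifs with hm
  · rw [hm, gaussTerm_zero]
  · simp [gaussTerm, hm]

theorem continuousAt_gaussTerm (hq : ‖q‖ < 1) (m : ℕ) :
    ContinuousAt (fun s => gaussTerm A B u v s q m) 0 := by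
  refine ContinuousAt.div (by fun_prop) ?_ ?_
  · unfold qPoch
    fun_prop
  · simpa [qPoch_zero_left] using qPoch_self_ne_zero hq m

theorem tendsto_tsum_gaussTerm (hq : ‖q‖ < 1) (hc : ∀ n : ℕ, u * v * t * q ^ n ≠ 1)
    (hABt : ‖A * B * t‖ < 1) :
    Tendsto (fun N : ℕ => ∑' m, gaussTerm A B u v (t * q ^ N) q m) atTop (𝓝 1) := by
  obtain ⟨K, ρ, -, hρ₀, hρ₁, hK⟩ := exists_norm_gaussTerm_le hq hABt hc u v
  have hlim : Tendsto (fun N : ℕ => t * q ^ N) atTop (𝓝 0) := by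
    simpa using (tendsto_pow_atTop_nhds_zero_of_norm_lt_one hq).const_mul t
  have hterm : ∀ m, Tendsto (fun N : ℕ => gaussTerm A B u v (t * q ^ N) q m) atTop
      (𝓝 (if m = 0 then 1 else 0)) := fun m => by
    rw [← gaussTerm_zero_argument]
    exact (continuousAt_gaussTerm hq m).tendsto.comp hlim
  have htannery := tendsto_tsum_of_dominated_convergence
    ((summable_geometric_of_lt_one hρ₀ hρ₁).mul_left K) hterm
    (Eventually.of_forall fun N => hK u v (t * q ^ N) N le_rfl le_rfl ?_ (by ring))
  · simpa using htannery
  · rw [norm_mul]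
    exact mul_le_of_le_one_right (norm_nonneg t) (norm_pow_le_one hq N)

theorem hasSum_gaussTerm (hq : ‖q‖ < 1) (hc : ∀ n : ℕ, u * v * t * q ^ n ≠ 1)
    (hABt : ‖A * B * t‖ < 1) :
    HasSum (gaussTerm A B u v t q) (qPochInf (A * v * t) q * qPochInf (B * u * t) q
      / (qPochInf (u * v * t) q * qPochInf (A * B * t) q)) := by
  have hlim := ((tendsto_qPoch (A * v * t) hq).mul (tendsto_qPoch (B * u * t) hq)).mul
    (tendsto_tsum_gaussTerm hq hc hABt)
  have hlim' := ((tendsto_qPoch (u * v * t) hq).mul (tendsto_qPoch (A * B * t) hq)).mul_const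
    (∑' m, gaussTerm A B u v t q m)
  have hvalue := tendsto_nhds_unique
    (hlim'.congr fun N => tsum_gaussTerm_iterate hq hc hABt N) hlim
  have hne : qPochInf (u * v * t) q * qPochInf (A * B * t) q ≠ 0 :=
    mul_ne_zero (qPochInf_ne_zero hq hc) (qPochInf_ne_zero hq (mul_pow_ne_one hq hABt))
  rw [mul_one, mul_comm, ← eq_div_iff hne] at hvalue
  exact hvalue ▸ (summable_gaussTerm hq hc hABt).hasSum

end GaussSum

section BaileyLemma

/-- The general term of the double series over `(k, m)`, `n = k + m`, that appears when a Bailey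
pair is inserted in `∑ β n (u / A, v / B; q)_n (A B t) ^ n`. -/
noncomputable def baileyTerm (α : ℕ → ℂ) (A B u v t q : ℂ) (p : ℕ × ℕ) : ℂ :=
  α p.1 * (homQPoch A u q (p.1 + p.2) * homQPoch B v q (p.1 + p.2) * t ^ (p.1 + p.2))
    / (qPoch q q p.2 * qPoch (u * v * t) q (2 * p.1 + p.2))

variable {α β : ℕ → ℂ} {a A B u v t q : ℂ}

theorem baileyTerm_eq_mul_gaussTerm (α : ℕ → ℂ) (A B u v t q : ℂ) (k m : ℕ) :
    baileyTerm α A B u v t q (k, m)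
      = α k * (homQPoch A u q k * homQPoch B v q k * t ^ k) * (qPoch (u * v * t) q (2 * k))⁻¹
        * gaussTerm A B (u * q ^ k) (v * q ^ k) t q m := by
  have hshift : u * q ^ k * (v * q ^ k) * t = u * v * t * q ^ (2 * k) := by ring
  rw [baileyTerm, gaussTerm, homQPoch_add, homQPoch_add, qPoch_add, hshift]
  simp only [div_eq_mul_inv, mul_inv, pow_add]
  ring

theorem summable_baileyTerm (hq : ‖q‖ < 1) (hc : ∀ n : ℕ, u * v * t * q ^ n ≠ 1)
    (hABt : ‖A * B * t‖ < 1)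
    (hα : Summable fun k => α k * (homQPoch A u q k * homQPoch B v q k * t ^ k)) :
    Summable (baileyTerm α A B u v t q) := by
  obtain ⟨K, ρ, hK₀, hρ₀, hρ₁, hK⟩ := exists_norm_gaussTerm_le hq hABt hc u v
  obtain ⟨C, hC₀, hC⟩ := exists_norm_inv_qPoch_le hq hc
  have hmul_le : ∀ (z : ℂ) (k : ℕ), ‖z * q ^ k‖ ≤ ‖z‖ := fun z k => by
    rw [norm_mul]
    exact mul_le_of_le_one_right (norm_nonneg z) (norm_pow_le_one hq k)
  refine ((hα.norm.mul_right C).mul_of_nonneg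
    ((summable_geometric_of_lt_one hρ₀ hρ₁).mul_left K) (fun k => by positivity)
    fun m => by positivity).of_norm_bounded fun ⟨k, m⟩ => ?_
  rw [baileyTerm_eq_mul_gaussTerm, norm_mul, norm_mul]
  gcongr
  · exact hC _
  · exact hK _ _ t (2 * k) (hmul_le u k) (hmul_le v k) le_rfl (by ring) m

theorem hasSum_baileyTerm_row (hq : ‖q‖ < 1) (hc : ∀ n : ℕ, u * v * t * q ^ n ≠ 1)
    (hA : ∀ n : ℕ, A * v * t * q ^ n ≠ 1) (hB : ∀ n : ℕ, B * u * t * q ^ n ≠ 1)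
    (hABt : ‖A * B * t‖ < 1) (k : ℕ) :
    HasSum (fun m => baileyTerm α A B u v t q (k, m))
      (qPochInf (A * v * t) q * qPochInf (B * u * t) q
          / (qPochInf (u * v * t) q * qPochInf (A * B * t) q)
        * (α k * (homQPoch A u q k * homQPoch B v q k * t ^ k
          / (qPoch (A * v * t) q k * qPoch (B * u * t) q k)))) := by
  have hshift : u * q ^ k * (v * q ^ k) * t = u * v * t * q ^ (2 * k) := by ring
  have hshiftA : A * (v * q ^ k) * t = A * v * t * q ^ k := by ring
  have hshiftB : B * (u * q ^ k) * t = B * u * t * q ^ k := by ring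
  have hgauss := hasSum_gaussTerm (A := A) (B := B) (u := u * q ^ k) (v := v * q ^ k) (t := t) hq
    (by simpa only [hshift] using mul_pow_mul_pow_ne_one hc (2 * k)) hABt
  simp only [baileyTerm_eq_mul_gaussTerm]
  refine (congrArg (HasSum _ · _) ?_).mpr (hgauss.mul_left _)
  rw [hshift, hshiftA, hshiftB, qPochInf_eq_qPoch_mul (A * v * t) hq k,
    qPochInf_eq_qPoch_mul (B * u * t) hq k, qPochInf_eq_qPoch_mul (u * v * t) hq (2 * k)]
  have hAk := qPoch_ne_zero hA k
  have hBk := qPoch_ne_zero hB k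
  have hck := qPoch_ne_zero hc (2 * k)
  generalize qPoch (A * v * t) q k = x at *
  generalize qPoch (B * u * t) q k = y at *
  generalize qPoch (u * v * t) q (2 * k) = z at *
  field_simp

theorem sum_antidiagonal_baileyTerm (h : IsBaileyPair a q α β) (ha : a * q = u * v * t) (n : ℕ) :
    ∑ p ∈ antidiagonal n, baileyTerm α A B u v t q p
      = β n * (homQPoch A u q n * homQPoch B v q n * t ^ n) := by
  rw [Nat.sum_antidiagonal_eq_sum_range_succ_mk, h n, ha, sum_mul]
  refine sum_congr rfl fun k hk => ?_
  have hkn : k ≤ n := Nat.lt_succ_iff.mp (mem_range.mp hk)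
  rw [baileyTerm, Nat.add_sub_cancel' hkn, show 2 * k + (n - k) = n + k by omega]
  ring

/-- **Bailey's lemma**, with parameters `u / A` and `v / B`. -/
theorem IsBaileyPair.hasSum_mul_homQPoch (h : IsBaileyPair a q α β) (hq : ‖q‖ < 1)
    (ha : a * q = u * v * t) (hc : ∀ n : ℕ, u * v * t * q ^ n ≠ 1)
    (hA : ∀ n : ℕ, A * v * t * q ^ n ≠ 1) (hB : ∀ n : ℕ, B * u * t * q ^ n ≠ 1)
    (hABt : ‖A * B * t‖ < 1)
    (hα : Summable fun k => α k * (homQPoch A u q k * homQPoch B v q k * t ^ k)) :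
    HasSum (fun n => β n * (homQPoch A u q n * homQPoch B v q n * t ^ n))
      (qPochInf (A * v * t) q * qPochInf (B * u * t) q
          / (qPochInf (u * v * t) q * qPochInf (A * B * t) q)
        * ∑' k, α k * (homQPoch A u q k * homQPoch B v q k * t ^ k
          / (qPoch (A * v * t) q k * qPoch (B * u * t) q k))) := by
  have hsum := (summable_baileyTerm hq hc hABt hα).hasSum
  have hrows := hsum.prod_fiberwise fun k => hasSum_baileyTerm_row hq hc hA hB hABt k
  have hdiag := (HasAntidiagonal.sigmaAntidiagonalEquivProd.hasSum_iff.mpr hsum).sigma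
    fun n => hasSum_fintype _
  rw [← hrows.tsum_eq, tsum_mul_left] at hdiag
  refine hdiag.congr_fun fun n => ?_
  rw [← sum_antidiagonal_baileyTerm h ha]
  exact (sum_coe_sort (antidiagonal n) (baileyTerm α A B u v t q)).symm

end BaileyLemma

section CubicTransformation

variable {A B u v t q : ℂ}

/-- The `k = 3 * r` term of the `α`-side of Bailey's lemma for the cubic Bailey pair, multiplied by
`1 - q ^ 3`. The other values of `k` contribute nothing. -/
noncomputable def cubicTerm (A B u v t q : ℂ) (r : ℕ) : ℂ :=
  (-1) ^ r * q ^ (3 * r + 1).choose 2 * (1 - q ^ (6 * r + 3))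
    * (homQPoch A u q (3 * r) * homQPoch B v q (3 * r) * t ^ (3 * r)
      / (qPoch (A * v * t) q (3 * r) * qPoch (B * u * t) q (3 * r)))

theorem norm_cubicAlpha_le (hq : ‖q‖ < 1) (k : ℕ) : ‖cubicAlpha q k‖ ≤ 2 / ‖1 - q ^ 3‖ := by
  rw [cubicAlpha]
  split_ifs
  · have hnum : ‖1 - q ^ (2 * k + 3)‖ ≤ 2 := by
      calc ‖1 - q ^ (2 * k + 3)‖ ≤ ‖(1 : ℂ)‖ + ‖q ^ (2 * k + 3)‖ := norm_sub_le _ _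
        _ ≤ 1 + 1 := by rw [norm_one]; gcongr; exact norm_pow_le_one hq _
        _ = 2 := one_add_one_eq_two
    rw [norm_div, norm_mul, norm_mul, norm_pow, norm_neg, norm_one, one_pow, one_mul]
    gcongr
    exact (mul_le_of_le_one_left (norm_nonneg _) (norm_pow_le_one hq _)).trans hnum
  · rw [norm_zero]
    positivity

theorem summable_cubicAlpha_mul (hq : ‖q‖ < 1) (hABt : ‖A * B * t‖ < 1) (u v : ℂ) :
    Summable fun k => cubicAlpha q k * (homQPoch A u q k * homQPoch B v q k * t ^ k) := by
  obtain ⟨K, ρ, -, hρ₀, hρ₁, hK⟩ := exists_norm_homQPoch_mul_le hq hABt u v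
  refine (((summable_geometric_of_lt_one hρ₀ hρ₁).mul_left K).mul_left
    (2 / ‖1 - q ^ 3‖)).of_norm_bounded fun k => ?_
  rw [norm_mul]
  gcongr
  exacts [norm_cubicAlpha_le hq k, hK u v le_rfl le_rfl k]

theorem summable_cubicAlpha_mul_div (hq : ‖q‖ < 1) (hABt : ‖A * B * t‖ < 1)
    (hA : ∀ n : ℕ, A * v * t * q ^ n ≠ 1) (hB : ∀ n : ℕ, B * u * t * q ^ n ≠ 1) :
    Summable fun k => cubicAlpha q k * (homQPoch A u q k * homQPoch B v q k * t ^ k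
      / (qPoch (A * v * t) q k * qPoch (B * u * t) q k)) := by
  obtain ⟨C, hC₀, hC⟩ := exists_norm_inv_qPoch_le hq hA
  obtain ⟨D, -, hD⟩ := exists_norm_inv_qPoch_le hq hB
  refine ((summable_cubicAlpha_mul hq hABt u v).norm.mul_right (C * D)).of_norm_bounded
    fun k => ?_
  rw [div_eq_mul_inv, ← mul_assoc, norm_mul, mul_inv, norm_mul _⁻¹]
  gcongr
  exacts [hC k, hD k]

theorem cubicAlpha_three_mul_mul (r : ℕ) :
    cubicAlpha q (3 * r) * (homQPoch A u q (3 * r) * homQPoch B v q (3 * r) * t ^ (3 * r)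
        / (qPoch (A * v * t) q (3 * r) * qPoch (B * u * t) q (3 * r)))
      = (1 - q ^ 3)⁻¹ * cubicTerm A B u v t q r := by
  rw [cubicAlpha, if_pos (dvd_mul_right 3 r), neg_one_pow_three_mul, ← mul_assoc 2 3 r,
    cubicTerm]
  ring

theorem hasSum_cubicTerm (hq : ‖q‖ < 1) (hABt : ‖A * B * t‖ < 1)
    (hA : ∀ n : ℕ, A * v * t * q ^ n ≠ 1) (hB : ∀ n : ℕ, B * u * t * q ^ n ≠ 1) :
    HasSum (cubicTerm A B u v t q) ((1 - q ^ 3) *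
      ∑' k, cubicAlpha q k * (homQPoch A u q k * homQPoch B v q k * t ^ k
        / (qPoch (A * v * t) q k * qPoch (B * u * t) q k))) := by
  have hne : 1 - q ^ 3 ≠ 0 := sub_ne_zero.mpr (pow_ne_one_of_norm_lt_one hq three_ne_zero).symm
  have hsum := (summable_cubicAlpha_mul_div hq hABt hA hB).hasSum
  rw [← (mul_right_injective₀ (three_ne_zero' ℕ)).hasSum_iff fun k hk => ?_] at hsum
  · refine (hsum.mul_left (1 - q ^ 3)).congr_fun fun r => ?_
    rw [Function.comp_apply, cubicAlpha_three_mul_mul, mul_inv_cancel_left₀ hne]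
  · rw [cubicAlpha, if_neg fun ⟨r, hr⟩ => hk ⟨r, hr.symm⟩, zero_mul]

theorem hasSum_cubicBeta_mul (hq : ‖q‖ < 1) (huvt : u * v * t = q ^ 4) (hABt : ‖A * B * t‖ < 1)
    (hA : ∀ n : ℕ, A * v * t * q ^ n ≠ 1) (hB : ∀ n : ℕ, B * u * t * q ^ n ≠ 1) :
    HasSum (fun n => cubicBeta q n * (homQPoch A u q n * homQPoch B v q n * t ^ n))
      (qPochInf (A * v * t) q * qPochInf (B * u * t) q
          / (qPochInf (q ^ 3) q * qPochInf (A * B * t) q)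
        * ∑' r, cubicTerm A B u v t q r) := by
  have hne : 1 - q ^ 3 ≠ 0 := sub_ne_zero.mpr (pow_ne_one_of_norm_lt_one hq three_ne_zero).symm
  have hshift : qPochInf (q ^ 3) q = (1 - q ^ 3) * qPochInf (q ^ 4) q := by
    rw [qPochInf_eq_qPoch_mul (q ^ 3) hq 1, pow_one, ← pow_succ]
    simp [qPoch]
  have hc : ∀ n : ℕ, u * v * t * q ^ n ≠ 1 := by
    rw [huvt]
    exact mul_pow_ne_one hq (norm_pow_lt_one hq four_ne_zero)
  have hbailey := (isBaileyPair_cubic hq).hasSum_mul_homQPoch hq (by rw [huvt]; ring) hc hA hB hABt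
    (summable_cubicAlpha_mul hq hABt u v)
  refine (congrArg (HasSum _ · _) ?_).mpr hbailey
  rw [(hasSum_cubicTerm hq hABt hA hB).tsum_eq, hshift, huvt, ← mul_assoc]
  congr 1
  field_simp

theorem hasSum_of_hasSum_cubicTerm (hq : ‖q‖ < 1) (huvt : u * v * t = q ^ 4)
    (hABt : ‖A * B * t‖ < 1)
    (hA : ∀ n : ℕ, A * v * t * q ^ n ≠ 1) (hB : ∀ n : ℕ, B * u * t * q ^ n ≠ 1) {S : ℂ}
    (hS : HasSum (cubicTerm A B u v t q) S) :
    HasSum (fun n => qPoch (q ^ 3) (q ^ 3) n / (qPoch q q n * qPoch q q (2 * n + 2))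
        * (homQPoch A u q n * homQPoch B v q n * t ^ n))
      (qPochInf (A * v * t) q * qPochInf (B * u * t) q
        / (qPochInf q q * qPochInf (A * B * t) q) * S) := by
  have hscaled := (hasSum_cubicBeta_mul hq huvt hABt hA hB).mul_left ((1 - q) * (1 - q ^ 2))⁻¹
  rw [hS.tsum_eq] at hscaled
  refine (congrArg₂ HasSum (funext fun n => ?_) ?_).mpr hscaled
  · rw [cubicBeta, qPoch_self_add_two]
    simp only [div_eq_mul_inv, mul_inv]
    ring
  · rw [qPochInf_self_eq hq]
    simp only [div_eq_mul_inv, mul_inv]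
    ring

end CubicTransformation

section TwoParameterTransformation

variable {a b q : ℂ}

theorem cubicTerm_div_div (ha : a ≠ 0) (hb : b ≠ 0) (r : ℕ) :
    cubicTerm 1 1 (q / a) (q / b) (a * b * q ^ 2) q r
      = (-1) ^ r * (1 - q ^ (6 * r + 3))
        * (qPoch (q / a) q (3 * r) * qPoch (q / b) q (3 * r)
          / (qPoch (a * q ^ 3) q (3 * r) * qPoch (b * q ^ 3) q (3 * r)))
        * (a * b) ^ (3 * r) * q ^ ((9 * r ^ 2 + 15 * r) / 2) := by
  have hexp : (9 * r ^ 2 + 15 * r) / 2 = (3 * r + 1).choose 2 + 6 * r := by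
    rw [sq_eq_two_mul_choose_two_add, choose_two_succ, choose_two_three_mul]
    omega
  have hav : 1 * (q / b) * (a * b * q ^ 2) = a * q ^ 3 := by field_simp
  have hbu : 1 * (q / a) * (a * b * q ^ 2) = b * q ^ 3 := by field_simp
  rw [cubicTerm, hav, hbu, homQPoch_one_left, homQPoch_one_left, hexp]
  ring

theorem cubic_transformation (hq : ‖q‖ < 1) (ha : a ≠ 0) (hb : b ≠ 0)
    (haq : ∀ n : ℕ, a * q ^ 3 * q ^ n ≠ 1) (hbq : ∀ n : ℕ, b * q ^ 3 * q ^ n ≠ 1)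
    (hab : ‖a * b * q ^ 2‖ < 1) :
    HasSum (fun n : ℕ => qPoch (q / a) q n * qPoch (q / b) q n * qPoch (q ^ 3) (q ^ 3) n
        / (qPoch q q n * qPoch (q ^ 3) q (2 * n)) * (a * b) ^ n * q ^ (2 * n))
      (qPochInf (a * q ^ 3) q * qPochInf (b * q ^ 3) q
          / (qPochInf (q ^ 3) q * qPochInf (a * b * q ^ 2) q)
        * ∑' r, cubicTerm 1 1 (q / a) (q / b) (a * b * q ^ 2) q r) ∧
      Summable (cubicTerm 1 1 (q / a) (q / b) (a * b * q ^ 2) q) := by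
  have hav : 1 * (q / b) * (a * b * q ^ 2) = a * q ^ 3 := by field_simp
  have hbu : 1 * (q / a) * (a * b * q ^ 2) = b * q ^ 3 := by field_simp
  have huvt : q / a * (q / b) * (a * b * q ^ 2) = q ^ 4 := by field_simp
  have hABt : ‖1 * 1 * (a * b * q ^ 2)‖ < 1 := by simpa only [one_mul] using hab
  rw [← hav] at haq
  rw [← hbu] at hbq
  refine ⟨?_, (hasSum_cubicTerm hq hABt haq hbq).summable⟩
  have hsum := hasSum_cubicBeta_mul hq huvt hABt haq hbq
  rw [hav, hbu, one_mul, one_mul] at hsum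
  refine hsum.congr_fun fun n => ?_
  rw [cubicBeta, homQPoch_one_left, homQPoch_one_left]
  ring

end TwoParameterTransformation

section Slater

variable {q : ℂ}

theorem cubicTerm_zero_one_neg_sq (hq : ‖q‖ < 1) (r : ℕ) :
    cubicTerm 0 1 1 (-q ^ 2) (-q ^ 2) q r
      = (-1) ^ r * ((q ^ 15) ^ r * (q ^ 18) ^ r.choose 2
        - (q ^ 3) ^ (r + 1) * (q ^ 18) ^ (r + 1).choose 2) := by
  have hne : qPoch (-q ^ 2) q (3 * r) ≠ 0 :=
    qPoch_ne_zero (mul_pow_ne_one hq (by simpa using norm_pow_lt_one hq two_ne_zero)) _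
  simp only [cubicTerm, homQPoch_zero_left, homQPoch_one_left, zero_mul, one_mul, qPoch_zero_left,
    choose_two_succ, choose_two_three_mul, neg_one_pow_three_mul, neg_pow (q ^ 2)]
  rw [mul_right_comm _ (qPoch _ _ _), mul_div_cancel_right₀ _ hne]
  rcases neg_one_pow_eq_or ℂ r with hr | hr <;> rw [hr] <;> ring

theorem slater76 (hq : ‖q‖ < 1) :
    HasSum (fun n : ℕ => qPoch (-q) q (n + 1) * qPoch (q ^ 3) (q ^ 3) n
        / (qPoch q q n * qPoch q q (2 * n + 2)) * q ^ ((n ^ 2 + 3 * n) / 2))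
      (qPochInf (-q) q
        * (qPochInf (q ^ 3) (q ^ 18) * qPochInf (q ^ 15) (q ^ 18) * qPochInf (q ^ 18) (q ^ 18))
        / qPochInf q q) := by
  have hne : ∀ n : ℕ, 1 * 1 * -q ^ 2 * q ^ n ≠ 1 := by
    simpa using mul_pow_ne_one hq (a := -q ^ 2) (by simpa using norm_pow_lt_one hq two_ne_zero)
  have htheta := (hasSum_thetaTerm_fold (x := q ^ 15) (y := q ^ 3)
    (norm_pow_lt_one hq (show 18 ≠ 0 by decide)) (by ring)).congr_fun
    fun r => cubicTerm_zero_one_neg_sq hq r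
  have hsum := (hasSum_of_hasSum_cubicTerm hq (by ring) (by simp) (by simp) hne htheta).mul_left
    (1 + q)
  refine (congrArg₂ HasSum (funext fun n => ?_) ?_).mpr hsum
  · have hexp : (n ^ 2 + 3 * n) / 2 = n.choose 2 + 2 * n := by
      rw [sq_eq_two_mul_choose_two_add]
      omega
    rw [hexp, qPoch_succ', homQPoch_zero_left, homQPoch_one_left, neg_pow (q ^ 2),
      show -q * q = -q ^ 2 by ring]
    rcases neg_one_pow_eq_or ℂ n with hn | hn <;> rw [hn] <;> ring
  · rw [qPochInf_eq_qPoch_mul (-q) hq 1, pow_one, show -q * q = -q ^ 2 by ring]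
    simp only [zero_mul, one_mul, qPochInf_zero_left, qPoch_succ, qPoch_zero]
    ring

theorem cubicTerm_zero_zero (q : ℂ) (r : ℕ) :
    cubicTerm 0 0 1 1 (q ^ 4) q r
      = (-1) ^ r * ((q ^ 24) ^ r * (q ^ 27) ^ r.choose 2
        - (q ^ 3) ^ (r + 1) * (q ^ 27) ^ (r + 1).choose 2) := by
  simp only [cubicTerm, homQPoch_zero_left, zero_mul, qPoch_zero_left, choose_two_succ,
    choose_two_three_mul, neg_one_pow_three_mul]
  rcases neg_one_pow_eq_or ℂ r with hr | hr <;> rw [hr] <;> ring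

theorem slater90 (hq : ‖q‖ < 1) :
    HasSum (fun n : ℕ => qPoch (q ^ 3) (q ^ 3) n
        / (qPoch q q n * qPoch q q (2 * n + 2)) * q ^ (n ^ 2 + 3 * n))
      (qPochInf (q ^ 3) (q ^ 27) * qPochInf (q ^ 24) (q ^ 27) * qPochInf (q ^ 27) (q ^ 27)
        / qPochInf q q) := by
  have htheta := (hasSum_thetaTerm_fold (x := q ^ 24) (y := q ^ 3)
    (norm_pow_lt_one hq (show 27 ≠ 0 by decide)) (by ring)).congr_fun
    fun r => cubicTerm_zero_zero q r
  have hsum := hasSum_of_hasSum_cubicTerm hq (by ring) (by simp) (by simp) (by simp) htheta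
  refine (congrArg₂ HasSum (funext fun n => ?_) ?_).mpr hsum
  · rw [homQPoch_zero_left, sq_eq_two_mul_choose_two_add]
    rcases neg_one_pow_eq_or ℂ n with hn | hn <;> rw [hn] <;> ring
  · simp only [zero_mul, qPochInf_zero_left]
    ring

theorem cubicTerm_zero_one_neg_cube (hq : ‖q‖ < 1) (r : ℕ) :
    cubicTerm 0 1 1 (-q ^ 3) (-q ^ 5) (q ^ 2) r
      = (1 + q ^ 3) * ((-1) ^ r * ((q ^ 33) ^ r * (q ^ 36) ^ r.choose 2
        - (q ^ 3) ^ (r + 1) * (q ^ 36) ^ (r + 1).choose 2)) := by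
  have hne : qPoch (-q ^ 5) (q ^ 2) (3 * r) ≠ 0 :=
    qPoch_ne_zero (mul_pow_ne_one (norm_pow_lt_one hq two_ne_zero)
      (by simpa using norm_pow_lt_one hq (show 5 ≠ 0 by decide))) _
  have hratio : qPoch (-q ^ 3) (q ^ 2) (3 * r) * (1 + q ^ (6 * r + 3))
      = (1 + q ^ 3) * qPoch (-q ^ 5) (q ^ 2) (3 * r) := by
    have hsplit := (qPoch_succ (-q ^ 3) (q ^ 2) (3 * r)).symm.trans (qPoch_succ' _ _ _)
    rw [show -q ^ 3 * q ^ 2 = -q ^ 5 by ring] at hsplit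
    linear_combination hsplit
  have hfactor : 1 - (q ^ 2) ^ (6 * r + 3) = (1 + q ^ (6 * r + 3)) * (1 - q ^ (6 * r + 3)) := by
    ring
  simp only [cubicTerm, homQPoch_zero_left, homQPoch_one_left, zero_mul, one_mul, qPoch_zero_left,
    choose_two_succ, choose_two_three_mul, neg_one_pow_three_mul, neg_pow (q ^ 5), hfactor]
  rw [← mul_div_assoc, div_eq_iff hne]
  rcases neg_one_pow_eq_or ℂ r with hr | hr <;> rw [hr]
  · linear_combination q ^ (36 * r.choose 2 + 33 * r) * (1 - q ^ (6 * r + 3)) * hratio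
  · linear_combination -q ^ (36 * r.choose 2 + 33 * r) * (1 - q ^ (6 * r + 3)) * hratio

theorem slater116 (hq : ‖q‖ < 1) :
    HasSum (fun n : ℕ => qPoch (-q) (q ^ 2) (n + 1) * qPoch (q ^ 6) (q ^ 6) n
        / (qPoch (q ^ 2) (q ^ 2) (2 * n + 2) * qPoch (q ^ 2) (q ^ 2) n) * q ^ (n ^ 2 + 4 * n))
      (qPochInf (-q) (q ^ 2)
        * (qPochInf (q ^ 3) (q ^ 36) * qPochInf (q ^ 33) (q ^ 36) * qPochInf (q ^ 36) (q ^ 36))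
        / qPochInf (q ^ 2) (q ^ 2)) := by
  have hq₂ : ‖q ^ 2‖ < 1 := norm_pow_lt_one hq two_ne_zero
  have hne : ∀ n : ℕ, 1 * 1 * -q ^ 5 * (q ^ 2) ^ n ≠ 1 := by
    simpa using mul_pow_ne_one hq₂ (a := -q ^ 5)
      (by simpa using norm_pow_lt_one hq (show 5 ≠ 0 by decide))
  have htheta := ((hasSum_thetaTerm_fold (x := q ^ 33) (y := q ^ 3)
    (norm_pow_lt_one hq (show 36 ≠ 0 by decide)) (by ring)).mul_left (1 + q ^ 3)).congr_fun
    fun r => cubicTerm_zero_one_neg_cube hq r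
  have hsum := (hasSum_of_hasSum_cubicTerm hq₂ (by ring) (by simp) (by simp) hne htheta).mul_left
    (1 + q)
  refine (congrArg₂ HasSum (funext fun n => ?_) ?_).mpr hsum
  · rw [sq_eq_two_mul_choose_two_add, qPoch_succ', homQPoch_zero_left, homQPoch_one_left,
      neg_pow (q ^ 5), show -q * q ^ 2 = -q ^ 3 by ring, show (q ^ 2) ^ 3 = q ^ 6 by ring]
    rcases neg_one_pow_eq_or ℂ n with hn | hn <;> rw [hn] <;> ring
  · rw [qPochInf_eq_qPoch_mul (-q) hq₂ 2, show -q * (q ^ 2) ^ 2 = -q ^ 5 by ring]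
    simp only [zero_mul, one_mul, qPochInf_zero_left, qPoch_succ, qPoch_zero]
    ring

end Slater

theorem theoremT1_general (q : ℂ) (hq : ‖q‖ < 1) :
    (∀ a b : ℂ, a ≠ 0 → b ≠ 0 →
      (∀ n : ℕ, a * q ^ 3 * q ^ n ≠ 1) → (∀ n : ℕ, b * q ^ 3 * q ^ n ≠ 1) → ‖a * b * q ^ 2‖ < 1 →
      Summable (fun n : ℕ =>
        qPoch (q / a) q n * qPoch (q / b) q n * qPoch (q ^ 3) (q ^ 3) n
          / (qPoch q q n * qPoch (q ^ 3) q (2 * n)) * (a * b) ^ n * q ^ (2 * n)) ∧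
      Summable (fun n : ℕ =>
        (-1 : ℂ) ^ n * (1 - q ^ (6 * n + 3))
          * (qPoch (q / a) q (3 * n) * qPoch (q / b) q (3 * n)
            / (qPoch (a * q ^ 3) q (3 * n) * qPoch (b * q ^ 3) q (3 * n)))
          * (a * b) ^ (3 * n) * q ^ ((9 * n ^ 2 + 15 * n) / 2)) ∧
      qPochInf (q ^ 3) q * qPochInf (a * b * q ^ 2) q
          / (qPochInf (a * q ^ 3) q * qPochInf (b * q ^ 3) q)
          * ∑' n : ℕ,
            qPoch (q / a) q n * qPoch (q / b) q n * qPoch (q ^ 3) (q ^ 3) n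
              / (qPoch q q n * qPoch (q ^ 3) q (2 * n)) * (a * b) ^ n * q ^ (2 * n)
        = ∑' n : ℕ,
            (-1 : ℂ) ^ n * (1 - q ^ (6 * n + 3))
              * (qPoch (q / a) q (3 * n) * qPoch (q / b) q (3 * n)
                / (qPoch (a * q ^ 3) q (3 * n) * qPoch (b * q ^ 3) q (3 * n)))
              * (a * b) ^ (3 * n) * q ^ ((9 * n ^ 2 + 15 * n) / 2)) ∧
    HasSum (fun n : ℕ =>
        qPoch (-q) q (n + 1) * qPoch (q ^ 3) (q ^ 3) n
          / (qPoch q q n * qPoch q q (2 * n + 2)) * q ^ ((n ^ 2 + 3 * n) / 2))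
      (qPochInf (-q) q
        * (qPochInf (q ^ 3) (q ^ 18) * qPochInf (q ^ 15) (q ^ 18) * qPochInf (q ^ 18) (q ^ 18))
        / qPochInf q q) ∧
    HasSum (fun n : ℕ =>
        qPoch (q ^ 3) (q ^ 3) n
          / (qPoch q q n * qPoch q q (2 * n + 2)) * q ^ (n ^ 2 + 3 * n))
      (qPochInf (q ^ 3) (q ^ 27) * qPochInf (q ^ 24) (q ^ 27) * qPochInf (q ^ 27) (q ^ 27)
        / qPochInf q q) ∧
    HasSum (fun n : ℕ =>
        qPoch (-q) (q ^ 2) (n + 1) * qPoch (q ^ 6) (q ^ 6) n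
          / (qPoch (q ^ 2) (q ^ 2) (2 * n + 2) * qPoch (q ^ 2) (q ^ 2) n) * q ^ (n ^ 2 + 4 * n))
      (qPochInf (-q) (q ^ 2)
        * (qPochInf (q ^ 3) (q ^ 36) * qPochInf (q ^ 33) (q ^ 36) * qPochInf (q ^ 36) (q ^ 36))
        / qPochInf (q ^ 2) (q ^ 2)) := by
  refine ⟨fun a b ha hb haq hbq hab => ?_, slater76 hq, slater90 hq, slater116 hq⟩
  obtain ⟨hbeta, halpha⟩ := cubic_transformation hq ha hb haq hbq hab
  simp only [← cubicTerm_div_div ha hb]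
  refine ⟨hbeta.summable, halpha, ?_⟩
  have hfactor : qPochInf (a * q ^ 3) q * qPochInf (b * q ^ 3) q ≠ 0 :=
    mul_ne_zero (qPochInf_ne_zero hq haq) (qPochInf_ne_zero hq hbq)
  have hfactor' : qPochInf (q ^ 3) q * qPochInf (a * b * q ^ 2) q ≠ 0 :=
    mul_ne_zero (qPochInf_ne_zero hq (mul_pow_ne_one hq (norm_pow_lt_one hq three_ne_zero)))
      (qPochInf_ne_zero hq (mul_pow_ne_one hq hab))
  rw [hbeta.tsum_eq, ← mul_assoc, div_mul_div_cancel₀ hfactor, div_self hfactor', one_mul]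

theorem theoremT1 (q : ℂ) (hq : ‖q‖ < 1) :
    -- the two-parameter transformation, with convergence of both series
    (∀ a b : ℂ, a ≠ 0 → b ≠ 0 →
      ‖a * q ^ 3‖ < 1 → ‖b * q ^ 3‖ < 1 → ‖a * b * q ^ 2‖ < 1 →
      Summable (fun n : ℕ =>
        qPoch (q / a) q n * qPoch (q / b) q n * qPoch (q ^ 3) (q ^ 3) n
          / (qPoch q q n * qPoch (q ^ 3) q (2 * n)) * (a * b) ^ n * q ^ (2 * n)) ∧
      Summable (fun n : ℕ =>
        (-1 : ℂ) ^ n * (1 - q ^ (6 * n + 3))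
          * (qPoch (q / a) q (3 * n) * qPoch (q / b) q (3 * n)
            / (qPoch (a * q ^ 3) q (3 * n) * qPoch (b * q ^ 3) q (3 * n)))
          * (a * b) ^ (3 * n) * q ^ ((9 * n ^ 2 + 15 * n) / 2)) ∧
      qPochInf (q ^ 3) q * qPochInf (a * b * q ^ 2) q
          / (qPochInf (a * q ^ 3) q * qPochInf (b * q ^ 3) q)
          * ∑' n : ℕ,
            qPoch (q / a) q n * qPoch (q / b) q n * qPoch (q ^ 3) (q ^ 3) n
              / (qPoch q q n * qPoch (q ^ 3) q (2 * n)) * (a * b) ^ n * q ^ (2 * n)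
        = ∑' n : ℕ,
            (-1 : ℂ) ^ n * (1 - q ^ (6 * n + 3))
              * (qPoch (q / a) q (3 * n) * qPoch (q / b) q (3 * n)
                / (qPoch (a * q ^ 3) q (3 * n) * qPoch (b * q ^ 3) q (3 * n)))
              * (a * b) ^ (3 * n) * q ^ ((9 * n ^ 2 + 15 * n) / 2)) ∧
    -- (S.76)
    HasSum (fun n : ℕ =>
        qPoch (-q) q (n + 1) * qPoch (q ^ 3) (q ^ 3) n
          / (qPoch q q n * qPoch q q (2 * n + 2)) * q ^ ((n ^ 2 + 3 * n) / 2))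
      (qPochInf (-q) q
        * (qPochInf (q ^ 3) (q ^ 18) * qPochInf (q ^ 15) (q ^ 18) * qPochInf (q ^ 18) (q ^ 18))
        / qPochInf q q) ∧
    -- (S.90)
    HasSum (fun n : ℕ =>
        qPoch (q ^ 3) (q ^ 3) n
          / (qPoch q q n * qPoch q q (2 * n + 2)) * q ^ (n ^ 2 + 3 * n))
      (qPochInf (q ^ 3) (q ^ 27) * qPochInf (q ^ 24) (q ^ 27) * qPochInf (q ^ 27) (q ^ 27)
        / qPochInf q q) ∧
    -- (S.116)
    HasSum (fun n : ℕ =>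
        qPoch (-q) (q ^ 2) (n + 1) * qPoch (q ^ 6) (q ^ 6) n
          / (qPoch (q ^ 2) (q ^ 2) (2 * n + 2) * qPoch (q ^ 2) (q ^ 2) n) * q ^ (n ^ 2 + 4 * n))
      (qPochInf (-q) (q ^ 2)
        * (qPochInf (q ^ 3) (q ^ 36) * qPochInf (q ^ 33) (q ^ 36) * qPochInf (q ^ 36) (q ^ 36))
        / qPochInf (q ^ 2) (q ^ 2)) := by
  obtain ⟨htransformation, hslater⟩ := theoremT1_general q hq
  exact ⟨fun a b ha hb haq hbq => htransformation a b ha hb (mul_pow_ne_one hq haq)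
    (mul_pow_ne_one hq hbq), hslater⟩
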